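/- Let $1\le r\le p$, let $Z$ be a fixed $p\times r$ real matrix with linearly independent columns, $E$ the span of its columns, and $0\le a\le 1$. For each sample size $n$ let independent $\{0,1\}$-valued responses $Y_1,\dots,Y_n$ be observed at given predictor vectors $\mathbf{x}_1,\dots,\mathbf{x}_n\in\mathbb{R}^p$ (which may depend on $n$), following the multiple logistic model $P(Y_i=1)=p(\mathbf{x}_i)$, where $p(\mathbf{x})=1/[1+\exp(-\mathbf{x}'\beta)]$ with the same $\beta\in\mathbb{R}^p$ for all $n$. Let $F=F_n$ be the Fisher information matrix of the sample at $\beta$ and let $\hat\beta=\hat\beta_n$ be the maximum likelihood estimator. Assume that $\hat\beta$ is asymptotically $N_p(\beta,F^{-1})$, that is, $F_n$ is positive definite for all large $n$ and $F_n^{1/2}(\hat\beta_n-\beta)$ converges in distribution to $N_p(0,I_p)$. Let $$\mathscr{X}=\mathscr{X}_n=\{\mathbf{x}\in\mathbb{R}^p:\ \mathbf{x}'F^{-1}Z(Z'F^{-1}Z)^{-1}Z'F^{-1}\mathbf{x}\ \ge\ a^2\,\mathbf{x}'F^{-1}\mathbf{x}\}.$$ For $\mathbf{x}\ne 0$ the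 condition reads $\rho(\mathbf{x},E)\ge a$, where $\rho(\mathbf{x},E)=\{\mathbf{x}'F^{-1}Z(Z'F^{-1}Z)^{-1}Z'F^{-1}\mathbf{x}/\mathbf{x}'F^{-1}\mathbf{x}\}^{1/2}$. Let $F_{\chi}$ and $f_{\chi}$ be the distribution function and density of the $\chi^2_p$ distribution, $H$ the distribution function of the beta$(r/2,(p-r)/2)$ distribution (the point mass at $1$ if $r=p$), and $m(t)=\{at-[(1-a^2)(1-t^2)]^{1/2}\}^2$ for $0\le t\le 1$. Then there is a random variable $G\ge 0$ whose distribution function is, for $g\ge 0$, $$P(G\le g)=F_{\chi}(g)+\int_g^{g/(1-a^2)}H\bigl(m(\sqrt{g/w})\bigr)f_{\chi}(w)\,dw,$$ the upper limit being $\infty$ if $a=1$. Moreover, if $0<\alpha<1$ and $c_\alpha\ge 0$ satisfies $P(G\le c_\alpha^2)=1-\alpha$, then the bands $$\mathbf{x}'\beta\in\mathbf{x}'\hat\beta\pm c_\alpha(\mathbf{x}'F^{-1}\mathbf{x})^{1/2}$$ and $$\{1+\exp[-\mathbf{x}'\hat\beta+c_\alpha(\mathbf{x}'F^{-1}\mathbf{x})^{1/2}]\}^{-1}\le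 p(\mathbf{x})\le\{1+\exp[-\mathbf{x}'\hat\beta-c_\alpha(\mathbf{x}'F^{-1}\mathbf{x})^{1/2}]\}^{-1}$$ are large-sample $100(1-\alpha)\%$ simultaneous confidence bands over $\mathscr{X}$: for each of the two, the probability that the band holds for all $\mathbf{x}\in\mathscr{X}$ tends to $1-\alpha$ as $n\to\infty$. -/

import Mathlib

open MeasureTheory ProbabilityTheory Filter Topology Matrix
open scoped MatrixOrder

namespace LogisticBand

noncomputable section

/-! ### The multiple logistic model -/

/-- Response probability `p(x) = 1 / (1 + exp (-x'b))`. -/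
def responseProb {p : ℕ} (b x : Fin p → ℝ) : ℝ :=
  1 / (1 + Real.exp (-(x ⬝ᵥ b)))

/-- `Y 0, …, Y (n-1)` are independent responses with values in `{0, 1}`, observed at the
predictor vectors `X 0, …, X (n-1)`, that follow the logistic model with parameter `β`. -/
structure IsLogisticSample {p n : ℕ} {Ω : Type*} [MeasurableSpace Ω] (P : Measure Ω)
    (β : Fin p → ℝ) (X : Fin n → Fin p → ℝ) (Y : Fin n → Ω → ℝ) : Prop where
  measurable : ∀ i, Measurable (Y i)
  zero_or_one : ∀ i ω, Y i ω = 0 ∨ Y i ω = 1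
  indep : iIndepFun Y P
  prob_one : ∀ i, P.real {ω | Y i ω = 1} = responseProb β (X i)

/-- Log-likelihood at the parameter `b` of the responses `y` observed at `X`. -/
def logLik {p n : ℕ} (X : Fin n → Fin p → ℝ) (y : Fin n → ℝ) (b : Fin p → ℝ) : ℝ :=
  ∑ i, (y i * Real.log (responseProb b (X i)) + (1 - y i) * Real.log (1 - responseProb b (X i)))

/-- `est` is a maximum likelihood estimator: it maximizes the likelihood for every data set
for which a maximizer exists (for separated data there is none). -/
def IsMLE {p n : ℕ} {Ω : Type*} (X : Fin n → Fin p → ℝ) (Y : Fin n → Ω → ℝ)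
    (est : Ω → Fin p → ℝ) : Prop :=
  ∀ ω, (∃ b, ∀ b', logLik X (fun i => Y i ω) b' ≤ logLik X (fun i => Y i ω) b) →
    ∀ b', logLik X (fun i => Y i ω) b' ≤ logLik X (fun i => Y i ω) (est ω)

/-- `j`-th coordinate of the score, `∂ logLik / ∂ b_j`. -/
def score {p n : ℕ} (X : Fin n → Fin p → ℝ) (y : Fin n → ℝ) (b : Fin p → ℝ) (j : Fin p) : ℝ :=
  fderiv ℝ (logLik X y) b (Pi.single j 1)

/-- Fisher information matrix of the sample at `β`: the second moment matrix of the score. -/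
def fisherInfo {p n : ℕ} {Ω : Type*} [MeasurableSpace Ω] (P : Measure Ω)
    (β : Fin p → ℝ) (X : Fin n → Fin p → ℝ) (Y : Fin n → Ω → ℝ) : Matrix (Fin p) (Fin p) ℝ :=
  Matrix.of fun j k =>
    ∫ ω, score X (fun i => Y i ω) β j * score X (fun i => Y i ω) β k ∂P

/-- `est n` is asymptotically `N_p(β, (F n)⁻¹)`: the matrices `F n` are eventually positive
definite, and `(F n)^{1/2} (est n - β)` converges in distribution to `N_p(0, I)`. -/
def IsAsympNormal {p : ℕ} {Ω : ℕ → Type*} [∀ n, MeasurableSpace (Ω n)]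
    (P : ∀ n, Measure (Ω n)) [∀ n, IsProbabilityMeasure (P n)] (β : Fin p → ℝ)
    (F : ℕ → Matrix (Fin p) (Fin p) ℝ) (est : ∀ n, Ω n → Fin p → ℝ) : Prop :=
  (∀ᶠ n in atTop, (F n).PosDef) ∧
  TendstoInDistribution
    (fun n ω => (WithLp.toLp 2 (CFC.sqrt (F n) *ᵥ (est n ω - β)) : EuclideanSpace ℝ (Fin p)))
    atTop (id : EuclideanSpace ℝ (Fin p) → EuclideanSpace ℝ (Fin p)) P
    (stdGaussian (EuclideanSpace ℝ (Fin p)))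

/-! ### The constraint region and the bands -/

/-- The quadratic form `x'F⁻¹x`. -/
def quadInv {p : ℕ} (F : Matrix (Fin p) (Fin p) ℝ) (x : Fin p → ℝ) : ℝ :=
  x ⬝ᵥ (F⁻¹ *ᵥ x)

/-- The quadratic form `x'F⁻¹Z(Z'F⁻¹Z)⁻¹Z'F⁻¹x`. -/
def quadProj {p r : ℕ} (F : Matrix (Fin p) (Fin p) ℝ) (Z : Matrix (Fin p) (Fin r) ℝ)
    (x : Fin p → ℝ) : ℝ :=
  x ⬝ᵥ ((F⁻¹ * Z * (Zᵀ * F⁻¹ * Z)⁻¹ * Zᵀ * F⁻¹) *ᵥ x)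

/-- The multiple correlation coefficient `ρ(x, E)`, `E` the column span of `Z`. -/
def rho {p r : ℕ} (F : Matrix (Fin p) (Fin p) ℝ) (Z : Matrix (Fin p) (Fin r) ℝ)
    (x : Fin p → ℝ) : ℝ :=
  Real.sqrt (quadProj F Z x / quadInv F x)

/-- The constraint region. -/
def region {p r : ℕ} (F : Matrix (Fin p) (Fin p) ℝ) (Z : Matrix (Fin p) (Fin r) ℝ)
    (a : ℝ) : Set (Fin p → ℝ) :=
  {x | a ^ 2 * quadInv F x ≤ quadProj F Z x}

/-- Away from the origin, where `ρ` is undefined, the region is `{x | ρ(x, E) ≥ a}`. -/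
theorem mem_region_iff {p r : ℕ} {F : Matrix (Fin p) (Fin p) ℝ} (hF : F.PosDef)
    (Z : Matrix (Fin p) (Fin r) ℝ) {a : ℝ} (ha : 0 ≤ a) {x : Fin p → ℝ} (hx : x ≠ 0) :
    x ∈ region F Z a ↔ a ≤ rho F Z x := by
  have hpos : 0 < quadInv F x := by
    simpa [quadInv] using hF.inv.dotProduct_mulVec_pos hx
  have key : a ^ 2 ≤ quadProj F Z x / quadInv F x ↔ x ∈ region F Z a := by
    rw [le_div_iff₀ hpos]; rfl
  have hB : (F⁻¹ * Z)ᴴ = Zᵀ * F⁻¹ := by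
    rw [conjTranspose_mul, hF.inv.isHermitian.eq, conjTranspose_eq_transpose_of_trivial]
  have hS : (Zᵀ * F⁻¹ * Z).PosSemidef := by
    simpa [conjTranspose_eq_transpose_of_trivial] using
      hF.inv.posSemidef.conjTranspose_mul_mul_same Z
  have hproj : 0 ≤ quadProj F Z x := by
    have h := (hS.inv.mul_mul_conjTranspose_same (F⁻¹ * Z)).dotProduct_mulVec_nonneg x
    rw [hB] at h
    simpa [quadProj, Matrix.mul_assoc] using h
  rw [← key, rho, Real.le_sqrt ha]
  exact div_nonneg hproj hpos.le

/-- The band for the linear predictor, computed from the estimate `b`, contains `x'β` for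
all `x` in `S`. -/
def LinearBandCovers {p : ℕ} (F : Matrix (Fin p) (Fin p) ℝ) (S : Set (Fin p → ℝ)) (c : ℝ)
    (β b : Fin p → ℝ) : Prop :=
  ∀ x ∈ S, x ⬝ᵥ β ∈ Set.Icc (x ⬝ᵥ b - c * Real.sqrt (quadInv F x))
    (x ⬝ᵥ b + c * Real.sqrt (quadInv F x))

/-- The band for the response probability, computed from the estimate `b`, contains `p(x)` for
all `x` in `S`. -/
def ProbBandCovers {p : ℕ} (F : Matrix (Fin p) (Fin p) ℝ) (S : Set (Fin p → ℝ)) (c : ℝ)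
    (β b : Fin p → ℝ) : Prop :=
  ∀ x ∈ S, responseProb β x ∈ Set.Icc
    (1 + Real.exp (-(x ⬝ᵥ b) + c * Real.sqrt (quadInv F x)))⁻¹
    (1 + Real.exp (-(x ⬝ᵥ b) - c * Real.sqrt (quadInv F x)))⁻¹

/-! ### The distribution function that gives the critical value -/

/-- The chi-square distribution with `p` degrees of freedom. -/
def chiSq (p : ℕ) : Measure ℝ := gammaMeasure ((p : ℝ) / 2) (1 / 2)

/-- Density of the chi-square distribution with `p` degrees of freedom. -/
def chiSqDensity (p : ℕ) (w : ℝ) : ℝ := gammaPDFReal ((p : ℝ) / 2) (1 / 2) w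

/-- The distribution beta(`r / 2`, `(p - r) / 2`), which for `r = p` is the point mass at `1`. -/
def betaHalf (r p : ℕ) : Measure ℝ :=
  if r = p then Measure.dirac 1 else betaMeasure ((r : ℝ) / 2) (((p : ℝ) - r) / 2)

/-- `m(t) = (a t - ((1 - a²)(1 - t²))^{1/2})²`. -/
def mFun (a t : ℝ) : ℝ :=
  (a * t - Real.sqrt ((1 - a ^ 2) * (1 - t ^ 2))) ^ 2

/-- `F(g) + ∫_g^{g/(1-a²)} H(m(√(g/w))) f(w) dw`; the upper limit is `∞` if `a = 1`. -/
def critCDF (p r : ℕ) (a g : ℝ) : ℝ :=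
  cdf (chiSq p) g +
    if a = 1 then
      ∫ w in Set.Ioi g, cdf (betaHalf r p) (mFun a (Real.sqrt (g / w))) * chiSqDensity p w
    else
      ∫ w in g..(g / (1 - a ^ 2)),
        cdf (betaHalf r p) (mFun a (Real.sqrt (g / w))) * chiSqDensity p w

end

end LogisticBand

open LogisticBand

namespace LogisticBand

open scoped ENNReal

/-! ### Gamma, beta and chi-square distributions -/

/-! Geometry. Put `R = F^{1/2}`, `u = R⁻¹x` and let `z` be the standardized error `R(est - β)`. Then
`x'F⁻¹x` is `‖u‖²`, the quadratic form built from `Z` is the squared length of the projection of `u`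
on the span of `R⁻¹Z`, and `x'(est - β)` is the inner product of `u` and `z`. An isometry carrying
that span to the first `r` coordinates turns the region into the cone `a ^ 2 * ‖u‖ ^ 2 ≤ headSq u`,
the same for every `n`, so coverage means that the rotated error lies in the fixed set `coverSet`
(`linearBandCovers_iff_mem_coverSet`). The isometries need not converge, but the Gaussian limit is
rotation invariant, so compactness along subsequences suffices
(`tendsto_map_linearIsometryEquiv_stdGaussian`).

Law. The supremum of normalized contrasts over the cone is `‖z‖` times the cosine of the angle
between `z` and the cone (`mem_coverSet_iff`). Its square is `w * shrink a b`, where `w = ‖z‖²` and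
`b` is the share of the first block. For Gaussian `z` these are independent, chi-square and beta
(`map_normSq_headSq_div`). Solving `shrink a b ≤ g / w` for `b` produces `mFun`, and integrating
over `w` gives `critCDF` (`critLaw_real_Iic`). This law has no atom off `0`, so the frontier of
`coverSet` is null and weak convergence yields the limit. -/

theorem measurable_gammaPDF (α ρ : ℝ) : Measurable (gammaPDF α ρ) :=
  (measurable_gammaPDFReal α ρ).ennreal_ofReal

theorem measurable_betaPDF (α β : ℝ) : Measurable (betaPDF α β) :=
  (measurable_betaPDFReal α β).ennreal_ofReal

theorem lintegral_eq_mul_lintegral_comp_mul {f : ℝ → ℝ≥0∞} (hf : Measurable f) {w : ℝ}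
    (hw : 0 < w) : ∫⁻ s, f s = ENNReal.ofReal w * ∫⁻ b, f (w * b) := by
  have h := lintegral_map (μ := volume) hf (measurable_const_mul w)
  rw [Real.map_volume_mul_left hw.ne', lintegral_smul_measure, smul_eq_mul] at h
  rw [← h, ← mul_assoc, ← ENNReal.ofReal_mul hw.le, abs_of_pos (inv_pos.2 hw),
    mul_inv_cancel₀ hw.ne', ENNReal.ofReal_one, one_mul]

/-- Change of variables `(s, t) = (w b, w (1 - b))` at the level of densities, the leading `w` being
the Jacobian. The endpoints are excluded because `betaPDF` vanishes there while a gamma density of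
shape `1` does not vanish at `0`. -/
theorem mul_gammaPDF_mul_gammaPDF {α β ρ : ℝ} (hα : 0 < α) (hβ : 0 < β) (hρ : 0 < ρ) {w b : ℝ}
    (hw : 0 < w) (hb0 : b ≠ 0) (hb1 : b ≠ 1) :
    ENNReal.ofReal w * (gammaPDF α ρ (w * b) * gammaPDF β ρ (w - w * b)) =
      gammaPDF (α + β) ρ w * betaPDF α β b := by
  rcases lt_or_ge b 0 with hb | hb
  · rw [gammaPDF_of_neg (mul_neg_of_pos_of_neg hw hb), betaPDF_eq_zero_of_nonpos hb.le]
    simp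
  rcases lt_or_ge 1 b with hb' | hb'
  · rw [gammaPDF_of_neg (x := w - w * b) (by nlinarith), betaPDF_eq_zero_of_one_le hb'.le]
    simp
  have hb : 0 < b := lt_of_le_of_ne hb hb0.symm
  have hb' : 0 < 1 - b := sub_pos.2 (lt_of_le_of_ne hb' hb1)
  have hs : w - w * b = w * (1 - b) := by ring
  rw [hs, gammaPDF_of_nonneg (by positivity), gammaPDF_of_nonneg (by positivity),
    gammaPDF_of_nonneg hw.le, betaPDF_of_pos_lt_one hb (sub_pos.1 hb')]
  have hΓα := Real.Gamma_pos_of_pos hα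
  have hΓβ := Real.Gamma_pos_of_pos hβ
  have hΓ := Real.Gamma_pos_of_pos (add_pos hα hβ)
  rw [← ENNReal.ofReal_mul (by positivity), ← ENNReal.ofReal_mul (by positivity),
    ← ENNReal.ofReal_mul (by positivity)]
  congr 1
  have he : Real.exp (-(ρ * (w * b))) * Real.exp (-(ρ * (w * (1 - b)))) = Real.exp (-(ρ * w)) := by
    rw [← Real.exp_add]; congr 1; ring
  have hwp : w ^ (α + β - 1) = w * (w ^ (α - 1) * w ^ (β - 1)) := by
    rw [← Real.rpow_add hw, show α + β - 1 = 1 + (α - 1 + (β - 1)) by ring,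
      Real.rpow_add hw 1, Real.rpow_one]
  rw [Real.mul_rpow hw.le hb.le, Real.mul_rpow hw.le hb'.le, hwp, Real.rpow_add hρ, ← he,
    ProbabilityTheory.beta]
  field_simp

/-- The beta-gamma algebra: the sum and the ratio to the sum of independent gamma variables are
independent, with gamma and beta distributions. -/
theorem map_gamma_prod_gamma {α β ρ : ℝ} (hα : 0 < α) (hβ : 0 < β) (hρ : 0 < ρ) :
    ((gammaMeasure α ρ).prod (gammaMeasure β ρ)).map (fun x => (x.1 + x.2, x.1 / (x.1 + x.2))) =
      (gammaMeasure (α + β) ρ).prod (betaMeasure α β) := by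
  have := isProbabilityMeasure_gammaMeasure hα hρ
  have := isProbabilityMeasure_gammaMeasure hβ hρ
  have := isProbabilityMeasure_gammaMeasure (add_pos hα hβ) hρ
  have := isProbabilityMeasureBeta hα hβ
  have mα := measurable_gammaPDF α ρ
  have mβ := measurable_gammaPDF β ρ
  have mαβ := measurable_gammaPDF (α + β) ρ
  have mB := measurable_betaPDF α β
  refine Measure.ext_of_lintegral _ fun f hf => ?_
  rw [lintegral_map hf (by fun_prop), lintegral_prod _ (by fun_prop), lintegral_prod _ (by fun_prop)]
  unfold gammaMeasure betaMeasure
  have e1 : ∀ μ : Measure ℝ, ∀ g : ℝ → ℝ≥0∞, ∀ h : ℝ → ℝ≥0∞, Measurable g → Measurable h →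
      ∫⁻ x, h x ∂(μ.withDensity g) = ∫⁻ x, g x * h x ∂μ := fun μ g h hg hh => by
    rw [lintegral_withDensity_eq_lintegral_mul _ hg hh]; rfl
  rw [e1 _ _ _ mα (by
      refine Measurable.lintegral_prod_right' (f := fun z : ℝ × ℝ => f (z.1 + z.2, z.1 / (z.1 + z.2))) ?_
      fun_prop),
    e1 _ _ _ mαβ (Measurable.lintegral_prod_right' hf)]
  -- Substituting `t = w - s` makes the sum `w` a variable; after the swap of integrals, `s = w b`
  -- makes the ratio the other.
  have e2 : ∀ s, gammaPDF α ρ s * ∫⁻ t, f (s + t, s / (s + t)) ∂(volume.withDensity (gammaPDF β ρ)) =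
      ∫⁻ w, gammaPDF α ρ s * gammaPDF β ρ (w - s) * f (w, s / w) := fun s => by
    rw [e1 _ _ _ mβ (by fun_prop), ← lintegral_const_mul _ (by fun_prop),
      ← lintegral_sub_right_eq_self _ s]
    refine lintegral_congr fun w => ?_
    rw [add_sub_cancel, mul_assoc]
  simp_rw [e2]
  rw [lintegral_lintegral_swap (by fun_prop)]
  refine lintegral_congr_ae ?_
  filter_upwards [Measure.ae_ne volume (0 : ℝ)] with w hw
  rcases lt_or_gt_of_ne hw with hw | hw
  · rw [gammaPDF_of_neg hw, zero_mul]
    refine (lintegral_congr fun s => ?_).trans lintegral_zero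
    rcases lt_or_ge s 0 with hs | hs
    · rw [gammaPDF_of_neg hs, zero_mul, zero_mul]
    · rw [gammaPDF_of_neg (x := w - s) (by linarith), mul_zero, zero_mul]
  · rw [lintegral_eq_mul_lintegral_comp_mul (by fun_prop) hw, e1 _ _ _ mB (by fun_prop),
      ← lintegral_const_mul _ (by fun_prop), ← lintegral_const_mul _ (by fun_prop)]
    refine lintegral_congr_ae ?_
    filter_upwards [Measure.ae_ne volume (0 : ℝ), Measure.ae_ne volume (1 : ℝ)] with b hb0 hb1
    rw [mul_div_cancel_left₀ _ hw.ne', ← mul_assoc, ← mul_assoc (gammaPDF (α + β) ρ w), ←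
      mul_gammaPDF_mul_gammaPDF hα hβ hρ hw hb0 hb1]

theorem gamma_conv_gamma {α β ρ : ℝ} (hα : 0 < α) (hβ : 0 < β) (hρ : 0 < ρ) :
    ((gammaMeasure α ρ).prod (gammaMeasure β ρ)).map (fun x => x.1 + x.2) =
      gammaMeasure (α + β) ρ := by
  have := isProbabilityMeasureBeta hα hβ
  have h := congrArg (Measure.map Prod.fst) (map_gamma_prod_gamma hα hβ hρ)
  rw [Measure.map_map measurable_fst (by fun_prop), Measure.map_fst_prod, measure_univ,
    one_smul] at h
  exact h

/-- The factor `√y` is half the Jacobian `2√y` of squaring; the missing `2` is supplied by the two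
roots `±√y`. -/
theorem gaussianPDFReal_sqrt_div {y : ℝ} (hy : 0 < y) :
    gaussianPDFReal 0 1 (√y) = √y * gammaPDFReal (1 / 2) (1 / 2) y := by
  have hs := Real.sqrt_pos.2 hy
  rw [gaussianPDFReal, gammaPDFReal, if_pos hy.le, Real.Gamma_one_half_eq,
    show (1 / 2 - 1 : ℝ) = -(1 / 2) by norm_num, Real.rpow_neg hy.le, ← Real.sqrt_eq_rpow,
    ← Real.sqrt_eq_rpow, sub_zero, Real.sq_sqrt hy.le, NNReal.coe_one, mul_one, mul_one,
    Real.sqrt_mul zero_le_two, one_div, Real.sqrt_inv]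
  rw [show -y / 2 = -(2⁻¹ * y) by ring]
  field_simp

/-- The square of a standard normal variable has the chi-square distribution with one degree of
freedom. -/
theorem map_sq_gaussianReal :
    (gaussianReal 0 1).map (fun x => x ^ 2) = gammaMeasure (1 / 2) (1 / 2) := by
  have mG := measurable_gammaPDF (1 / 2) (1 / 2)
  have mN : Measurable (gaussianPDF 0 1) := measurable_gaussianPDF 0 1
  refine Measure.ext_of_lintegral _ fun f hf => ?_
  rw [lintegral_map hf (by fun_prop), gaussianReal_of_var_ne_zero _ one_ne_zero, gammaMeasure,
    lintegral_withDensity_eq_lintegral_mul _ mN (by fun_prop),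
    lintegral_withDensity_eq_lintegral_mul _ mG hf]
  simp only [Pi.mul_apply]
  have split : ∀ g : ℝ → ℝ≥0∞, ∫⁻ x, g x = (∫⁻ x in Set.Ioi 0, g x) + ∫⁻ x in Set.Iic 0, g x :=
    fun g => by rw [← lintegral_add_compl g (measurableSet_Ioi (a := (0 : ℝ))), Set.compl_Ioi]
  have hneg : ∫⁻ x in Set.Iic (0 : ℝ), gaussianPDF 0 1 x * f (x ^ 2) =
      ∫⁻ x in Set.Ioi (0 : ℝ), gaussianPDF 0 1 x * f (x ^ 2) := by
    rw [setLIntegral_congr Iio_ae_eq_Iic.symm]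
    have h := (Measure.measurePreserving_neg (volume : Measure ℝ)).setLIntegral_comp_preimage_emb
      (MeasurableEquiv.neg ℝ).measurableEmbedding
      (fun x => gaussianPDF 0 1 x * f (x ^ 2)) (Set.Ioi 0)
    rw [← h]
    simp only [Set.neg_preimage, Set.neg_Ioi, neg_zero, even_two, Even.neg_pow]
    refine lintegral_congr fun x => ?_
    simp [gaussianPDF, gaussianPDFReal]
  have hG : ∫⁻ x in Set.Iic (0 : ℝ), gammaPDF (1 / 2) (1 / 2) x * f x = 0 := by
    rw [setLIntegral_congr Iio_ae_eq_Iic.symm, setLIntegral_congr_fun (g := fun _ => 0)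
      measurableSet_Iio fun x hx => by rw [gammaPDF_of_neg hx, zero_mul]]
    simp
  rw [split, hneg, split (fun x => gammaPDF _ _ x * f x), hG, add_zero, ← two_mul]
  have himg : (fun x : ℝ => x ^ 2) '' Set.Ioi 0 = Set.Ioi 0 := by
    ext y
    constructor
    · rintro ⟨x, hx, rfl⟩
      exact pow_pos (Set.mem_Ioi.1 hx) 2
    · intro hy
      exact ⟨√y, Real.sqrt_pos.2 hy, Real.sq_sqrt (le_of_lt hy)⟩
  have hinj : Set.InjOn (fun x : ℝ => x ^ 2) (Set.Ioi 0) := fun x hx y hy h =>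
    (pow_left_inj₀ (le_of_lt hx) (le_of_lt hy) two_ne_zero).1 h
  conv_rhs => rw [← himg]
  rw [lintegral_image_eq_lintegral_abs_deriv_mul measurableSet_Ioi (f' := fun x => 2 * x)
    (fun x _ => by simpa using (hasDerivAt_pow 2 x).hasDerivWithinAt) hinj,
    ← lintegral_const_mul _ (by fun_prop)]
  refine setLIntegral_congr_fun measurableSet_Ioi fun x hx => ?_
  have hx : 0 < x := hx
  have h := gaussianPDFReal_sqrt_div (pow_pos hx 2)
  rw [Real.sqrt_sq hx.le] at h
  simp only [gaussianPDF, gammaPDF]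
  rw [h, abs_of_pos (by positivity), ENNReal.ofReal_mul hx.le, ENNReal.ofReal_mul zero_le_two]
  simp [mul_assoc]

/-- The sum of the squares of independent standard normal variables. -/
theorem map_sum_sq_pi_gaussianReal (n : ℕ) :
    (Measure.pi fun _ : Fin (n + 1) => gaussianReal 0 1).map (fun x => ∑ i, x i ^ 2) =
      chiSq (n + 1) := by
  induction n with
  | zero =>
    have h := (measurePreserving_eval (fun _ : Fin 1 => gaussianReal 0 1) 0).map_eq
    have h2 := map_sq_gaussianReal
    rw [← h, Measure.map_map (by fun_prop) (by fun_prop)] at h2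
    simpa [chiSq, Function.comp_def] using h2
  | succ n ih =>
    have h := (measurePreserving_piFinSuccAbove (fun _ : Fin (n + 2) => gaussianReal 0 1) 0).map_eq
    have h2 := gamma_conv_gamma (α := 1 / 2) (β := ((n + 1 : ℕ) : ℝ) / 2) (ρ := 1 / 2) (by norm_num)
      (by positivity) (by norm_num)
    rw [← map_sq_gaussianReal, ← chiSq, ← ih, Measure.map_prod_map _ _ (by fun_prop) (by fun_prop),
      Measure.map_map (by fun_prop) (by fun_prop), ← h, Measure.map_map (by fun_prop)
        (MeasurableEquiv.measurable _)] at h2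
    rw [chiSq, show ((n + 1 + 1 : ℕ) : ℝ) / 2 = 1 / 2 + ((n + 1 : ℕ) : ℝ) / 2 by push_cast; ring,
      ← h2]
    congr 1
    funext x
    rw [Fin.sum_univ_succ]
    rfl

/-! ### The law of the critical statistic -/

theorem isProbabilityMeasure_chiSq {p : ℕ} (hp : 0 < p) : IsProbabilityMeasure (chiSq p) :=
  isProbabilityMeasure_gammaMeasure (by positivity) (by norm_num)

theorem isProbabilityMeasure_betaHalf {r p : ℕ} (hr : 1 ≤ r) (hrp : r ≤ p) :
    IsProbabilityMeasure (betaHalf r p) := by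
  unfold betaHalf
  split_ifs with h
  · infer_instance
  · have h1 : (0 : ℝ) < r := by exact_mod_cast hr
    have h2 : (r : ℝ) < p := by exact_mod_cast lt_of_le_of_ne hrp h
    exact isProbabilityMeasureBeta (by linarith) (by linarith)

theorem chiSq_absolutelyContinuous (p : ℕ) : chiSq p ≪ volume :=
  withDensity_absolutelyContinuous _ _

theorem ae_chiSq_pos (p : ℕ) : ∀ᵐ w ∂(chiSq p), 0 < w := by
  have h : chiSq p (Set.Iio 0) = 0 := by
    rw [chiSq, gammaMeasure, withDensity_apply _ measurableSet_Iio]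
    exact lintegral_gammaPDF_of_nonpos le_rfl
  have h0 : ∀ᵐ w ∂(chiSq p), w ≠ 0 :=
    (chiSq_absolutelyContinuous p).ae_le (Measure.ae_ne volume (0 : ℝ))
  have h1 : ∀ᵐ w ∂(chiSq p), 0 ≤ w := by
    rw [ae_iff]
    simpa [Set.Iio] using h
  filter_upwards [h0, h1] with w h0 h1 using lt_of_le_of_ne h1 h0.symm

theorem ae_betaHalf_mem (r p : ℕ) : ∀ᵐ b ∂(betaHalf r p), b ∈ Set.Ioc (0 : ℝ) 1 := by
  unfold betaHalf
  split_ifs with h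
  · exact (ae_dirac_iff (p := (· ∈ Set.Ioc (0 : ℝ) 1)) measurableSet_Ioc).2 (by simp)
  · rw [betaMeasure, ae_withDensity_iff (measurable_betaPDF _ _)]
    refine ae_of_all _ fun b hb => ?_
    by_contra hc
    rw [Set.mem_Ioc, not_and_or, not_lt, not_le] at hc
    rcases hc with hc | hc
    · exact hb (betaPDF_eq_zero_of_nonpos hc)
    · exact hb (betaPDF_eq_zero_of_one_le hc.le)

/-- The ratio of the squared supremum of the normalized contrasts over the constraint region to the
squared Euclidean norm, as a function of the fraction `b` of the latter in the first block. -/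
noncomputable def shrink (a b : ℝ) : ℝ :=
  if a ^ 2 ≤ b then 1 else (a * √b + √(1 - a ^ 2) * √(1 - b)) ^ 2

theorem measurable_shrink (a : ℝ) : Measurable (shrink a) :=
  Measurable.ite measurableSet_Ici measurable_const (by fun_prop)

theorem shrink_nonneg (a b : ℝ) : 0 ≤ shrink a b := by
  unfold shrink
  split_ifs <;> positivity

theorem shrink_le_one {a b : ℝ} (ha1 : a ^ 2 ≤ 1) (hb : 0 ≤ b) (hb1 : b ≤ 1) :
    shrink a b ≤ 1 := by
  unfold shrink
  split_ifs
  · exact le_rfl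
  · have h1 := Real.sq_sqrt (sub_nonneg.2 ha1)
    have h2 := Real.sq_sqrt hb
    have h3 := Real.sq_sqrt (sub_nonneg.2 hb1)
    nlinarith [sq_nonneg (a * √(1 - b) - √(1 - a ^ 2) * √b)]

/-- A signed square root of `mFun a t`. -/
noncomputable def mRoot (a t : ℝ) : ℝ := a * t - √((1 - a ^ 2) * (1 - t ^ 2))

theorem mFun_eq_mRoot_sq (a t : ℝ) : mFun a t = mRoot a t ^ 2 := rfl

/-- Both terms are monotone. For `a > 0` strictness comes from `a * t`, for `a = 0` only from the
square root. -/
theorem strictMonoOn_mRoot {a : ℝ} (ha0 : 0 ≤ a) (ha1 : a ≤ 1) :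
    StrictMonoOn (mRoot a) (Set.Icc 0 1) := by
  intro u hu v hv huv
  have hv2 : 0 ≤ 1 - v ^ 2 := by nlinarith [hv.1, hv.2]
  have huv2 : 1 - v ^ 2 < 1 - u ^ 2 := by nlinarith [hu.1]
  have ha2 : 0 ≤ 1 - a ^ 2 := by nlinarith
  unfold mRoot
  rcases ha0.eq_or_lt with rfl | ha
  · simpa using Real.sqrt_lt_sqrt hv2 huv2
  · have := Real.sqrt_le_sqrt (mul_le_mul_of_nonneg_left huv2.le ha2)
    nlinarith [mul_lt_mul_of_pos_left huv ha]

/-- With `t ^ 2 = g / w` this is the origin of the upper limit `g / (1 - a²)`. -/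
theorem mRoot_nonneg_iff {a t : ℝ} (ha0 : 0 ≤ a) (ht : 0 ≤ t) :
    0 ≤ mRoot a t ↔ 1 - a ^ 2 ≤ t ^ 2 := by
  rw [mRoot, sub_nonneg, Real.sqrt_le_left (by positivity)]
  constructor <;> intro h <;> nlinarith

/-- Write `a = cos φ`, `√b = cos θ`, `t = cos τ`. If `θ > φ`, then `shrink a b = cos² (θ - φ)` and
`mRoot a t = cos (φ + τ)`, so both sides say `θ ≥ φ + τ`. If `θ ≤ φ`, both fail, because `t < 1`
gives `mRoot a t < mRoot a 1 = a ≤ √b`. -/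
theorem shrink_le_sq_iff {a b t : ℝ} (ha0 : 0 ≤ a) (ha1 : a ≤ 1) (hb0 : 0 ≤ b) (hb1 : b ≤ 1)
    (ht0 : 0 ≤ t) (ht1 : t < 1) : shrink a b ≤ t ^ 2 ↔ √b ≤ mRoot a t := by
  have ha2 : 0 ≤ 1 - a ^ 2 := by nlinarith
  have hmono := strictMonoOn_mRoot ha0 ha1
  have ht : t ∈ Set.Icc (0 : ℝ) 1 := ⟨ht0, ht1.le⟩
  unfold shrink
  split_ifs with h
  · refine iff_of_false (by nlinarith) (not_le.2 ?_)
    have h1 := hmono ht ⟨zero_le_one, le_rfl⟩ ht1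
    refine h1.trans_le ?_
    simpa [mRoot] using Real.le_sqrt_of_sq_le h
  · have hx := Real.sq_sqrt hb0
    have hy := Real.sq_sqrt (sub_nonneg.2 hb1)
    have hc := Real.sq_sqrt ha2
    have hx0 := Real.sqrt_nonneg b
    have hy0 := Real.sqrt_nonneg (1 - b)
    have hc0 := Real.sqrt_nonneg (1 - a ^ 2)
    have hxa : √b ≤ a := Real.sqrt_le_iff.2 ⟨ha0, (not_le.1 h).le⟩
    have hcy : √(1 - a ^ 2) ≤ √(1 - b) := Real.sqrt_le_sqrt (by linarith [not_le.1 h])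
    set x := √b
    set y := √(1 - b)
    set c := √(1 - a ^ 2)
    have hu0 : 0 ≤ a * x + c * y := by positivity
    have hd : 0 ≤ a * y - c * x := by nlinarith [mul_le_mul hxa hcy hc0 ha0]
    have hsum : (a * x + c * y) ^ 2 + (a * y - c * x) ^ 2 = 1 := by
      have e : (a * x + c * y) ^ 2 + (a * y - c * x) ^ 2 = (a ^ 2 + c ^ 2) * (x ^ 2 + y ^ 2) := by
        ring
      rw [e, hx, hy, hc]
      ring
    have hu1 : a * x + c * y ≤ 1 := by nlinarith [sq_nonneg (a * y - c * x)]
    -- `mRoot a` undoes the rotation: `cos (φ + (θ - φ)) = cos θ`. Strict monotonicity then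
    -- transfers the inequality.
    have hroot : mRoot a (a * x + c * y) = x := by
      rw [mRoot, show 1 - (a * x + c * y) ^ 2 = (a * y - c * x) ^ 2 by linarith,
        Real.sqrt_mul ha2, Real.sqrt_sq hd]
      change a * (a * x + c * y) - c * (a * y - c * x) = x
      linear_combination x * hc
    rw [pow_le_pow_iff_left₀ hu0 ht0 two_ne_zero, ← hmono.le_iff_le ⟨hu0, hu1⟩ ht, hroot]

/-- The law of `w * shrink a b` for independent `w` and `b` with distributions `chiSq p` and
`betaHalf r p`. -/
noncomputable def critLaw (p r : ℕ) (a : ℝ) : Measure ℝ :=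
  ((chiSq p).prod (betaHalf r p)).map fun x => x.1 * shrink a x.2

theorem measurable_mul_shrink (a : ℝ) : Measurable fun x : ℝ × ℝ => x.1 * shrink a x.2 :=
  measurable_fst.mul ((measurable_shrink a).comp measurable_snd)

theorem isProbabilityMeasure_critLaw {p r : ℕ} (hr : 1 ≤ r) (hrp : r ≤ p) (a : ℝ) :
    IsProbabilityMeasure (critLaw p r a) := by
  have := isProbabilityMeasure_chiSq (hr.trans hrp)
  have := isProbabilityMeasure_betaHalf hr hrp
  exact Measure.isProbabilityMeasure_map (measurable_mul_shrink a).aemeasurable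

/-- For fixed `b` at most one `w` gives the value `g`, and the chi-square law has a density. At `g =
0` a vanishing `shrink a b` would break this. -/
theorem critLaw_singleton {p r : ℕ} (hr : 1 ≤ r) (hrp : r ≤ p) (a : ℝ) {g : ℝ} (hg : g ≠ 0) :
    critLaw p r a {g} = 0 := by
  have := isProbabilityMeasure_chiSq (hr.trans hrp)
  have := isProbabilityMeasure_betaHalf hr hrp
  have hm := measurable_mul_shrink a
  rw [critLaw, Measure.map_apply hm (measurableSet_singleton g),
    Measure.prod_apply_symm (hm (measurableSet_singleton g))]
  refine (lintegral_congr fun b => ?_).trans lintegral_zero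
  refine chiSq_absolutelyContinuous p ?_
  by_cases hb : shrink a b = 0
  · simp [Set.preimage, hb, hg.symm]
  · refine measure_mono_null (t := {g / shrink a b}) (fun w hw => ?_) Real.volume_singleton
    exact eq_div_of_mul_eq hb hw

/-- Conditional distribution function given `w`. The condition `w * (1 - a ^ 2) ≤ g`, kept free of
division, covers `a = 1` too; beyond it `mRoot` is negative and the event is empty. -/
theorem betaHalf_section {p r : ℕ} (hr : 1 ≤ r) (hrp : r ≤ p) {a : ℝ} (ha0 : 0 ≤ a) (ha1 : a ≤ 1)
    (g : ℝ) {w : ℝ} (hw : 0 < w) :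
    (betaHalf r p).real {b | w * shrink a b ≤ g} = (Set.Iic g).indicator (fun _ => 1) w +
      (Set.Ioi g ∩ {w | w * (1 - a ^ 2) ≤ g}).indicator
        (fun w => cdf (betaHalf r p) (mFun a √(g / w))) w := by
  have := isProbabilityMeasure_betaHalf hr hrp
  have ha2 : 0 ≤ 1 - a ^ 2 := by nlinarith
  rcases le_or_gt w g with h | h
  · rw [Set.indicator_of_mem (Set.mem_Iic.2 h), Set.indicator_of_notMem fun h' => h.not_gt h'.1,
      add_zero, ← probReal_univ (μ := betaHalf r p)]
    refine measureReal_congr ?_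
    filter_upwards [ae_betaHalf_mem r p] with b hb
    refine propext (iff_of_true ?_ trivial)
    change w * shrink a b ≤ g
    nlinarith [shrink_le_one (by linarith : a ^ 2 ≤ 1) hb.1.le hb.2]
  rw [Set.indicator_of_notMem (by simpa using h), zero_add]
  rcases lt_or_ge g 0 with hg | hg
  · rw [Set.indicator_of_notMem fun h' => (hg.trans_le (by positivity)).not_ge h'.2]
    convert measureReal_empty
    refine Set.eq_empty_of_forall_notMem fun b hb => ?_
    exact (hg.trans_le (mul_nonneg hw.le (shrink_nonneg a b))).not_ge hb
  have ht : √(g / w) ^ 2 = g / w := Real.sq_sqrt (by positivity)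
  have ht0 := Real.sqrt_nonneg (g / w)
  have ht1 : √(g / w) < 1 := by
    rw [Real.sqrt_lt' one_pos, one_pow, div_lt_one hw]
    exact h
  have hset : {b | w * shrink a b ≤ g} =ᵐ[betaHalf r p] {b | √b ≤ mRoot a √(g / w)} := by
    filter_upwards [ae_betaHalf_mem r p] with b hb
    refine propext ?_
    change w * shrink a b ≤ g ↔ √b ≤ mRoot a √(g / w)
    rw [← shrink_le_sq_iff ha0 ha1 hb.1.le hb.2 ht0 ht1, ht, le_div_iff₀ hw, mul_comm]
  have hroot : 0 ≤ mRoot a √(g / w) ↔ w * (1 - a ^ 2) ≤ g := by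
    rw [mRoot_nonneg_iff ha0 ht0, ht, le_div_iff₀ hw, mul_comm]
  rw [measureReal_congr hset]
  by_cases h1 : w * (1 - a ^ 2) ≤ g
  · rw [Set.indicator_of_mem (show w ∈ Set.Ioi g ∩ {w | w * (1 - a ^ 2) ≤ g} from ⟨h, h1⟩),
       cdf_eq_real, mFun_eq_mRoot_sq]
    congr 1
    ext b
    exact Real.sqrt_le_left (hroot.2 h1)
  · rw [Set.indicator_of_notMem fun h' => h1 h'.2]
    convert measureReal_empty
    refine Set.eq_empty_of_forall_notMem fun b hb => h1 (hroot.1 ?_)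
    exact (Real.sqrt_nonneg b).trans hb

theorem chiSqDensity_of_neg (p : ℕ) {w : ℝ} (hw : w < 0) : chiSqDensity p w = 0 := by
  rw [chiSqDensity, gammaPDFReal, if_neg hw.not_ge]

theorem integral_chiSq {p : ℕ} (hp : 0 < p) (f : ℝ → ℝ) :
    ∫ w, f w ∂(chiSq p) = ∫ w, f w * chiSqDensity p w := by
  rw [chiSq, gammaMeasure, integral_withDensity_eq_integral_toReal_smul (measurable_gammaPDF _ _)
    (ae_of_all _ fun _ => ENNReal.ofReal_lt_top)]
  refine integral_congr_ae (ae_of_all _ fun w => ?_)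
  change (ENNReal.ofReal _).toReal * f w = _
  rw [ENNReal.toReal_ofReal (gammaPDFReal_nonneg (by positivity) (by norm_num) w), mul_comm]
  rfl

theorem cdf_betaHalf_zero {p r : ℕ} (hr : 1 ≤ r) (hrp : r ≤ p) : cdf (betaHalf r p) 0 = 0 := by
  have := isProbabilityMeasure_betaHalf hr hrp
  rw [cdf_eq_real]
  refine (measureReal_congr (t := ∅) ?_).trans measureReal_empty
  filter_upwards [ae_betaHalf_mem r p] with b hb
  exact propext (iff_of_false hb.1.not_ge id)

/-- One formula for `a = 1` and `a < 1`. For `g < 0` the integrals vanish, since the density is zero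
on negative `w` and, when `a = 1`, the beta factor at `w ≥ 0` is its value at `0`. -/
theorem critCDF_eq {p r : ℕ} (hr : 1 ≤ r) (hrp : r ≤ p) {a : ℝ} (ha0 : 0 ≤ a) (ha1 : a ≤ 1)
    (g : ℝ) : critCDF p r a g = (chiSq p).real (Set.Iic g) +
      ∫ w in Set.Ioi g ∩ {w | w * (1 - a ^ 2) ≤ g},
        cdf (betaHalf r p) (mFun a √(g / w)) * chiSqDensity p w := by
  have := isProbabilityMeasure_chiSq (hr.trans hrp)
  rw [critCDF, cdf_eq_real]
  congr 1
  split_ifs with h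
  · subst h
    rcases lt_or_ge g 0 with hg | hg
    · rw [setIntegral_eq_zero_of_forall_eq_zero, setIntegral_eq_zero_of_forall_eq_zero]
      · rintro w ⟨-, hw⟩
        simp only [Set.mem_ofPred_eq, one_pow, sub_self, mul_zero] at hw
        exact absurd hw hg.not_ge
      · intro w hw
        rcases lt_or_ge w 0 with hw0 | hw0
        · rw [chiSqDensity_of_neg p hw0, mul_zero]
        · rw [Real.sqrt_eq_zero_of_nonpos (div_nonpos_of_nonpos_of_nonneg hg.le hw0)]
          simp [mFun, cdf_betaHalf_zero hr hrp]
    · congr 2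
      ext w
      simp [hg]
  · have ha2 : 0 < 1 - a ^ 2 := by nlinarith [lt_of_le_of_ne ha1 h]
    have hset : Set.Ioi g ∩ {w | w * (1 - a ^ 2) ≤ g} = Set.Ioc g (g / (1 - a ^ 2)) := by
      ext w
      simp [le_div_iff₀ ha2]
    rw [hset]
    rcases lt_or_ge g 0 with hg | hg
    · have h1 : g / (1 - a ^ 2) < 0 := div_neg_of_neg_of_pos hg ha2
      rw [intervalIntegral.integral_zero_ae, setIntegral_eq_zero_of_forall_eq_zero]
      · intro w hw
        rw [chiSqDensity_of_neg p (hw.2.trans_lt h1), mul_zero]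
      · refine ae_of_all _ fun w hw => ?_
        rw [chiSqDensity_of_neg p (hw.2.trans_lt (max_lt hg h1)), mul_zero]
    · refine intervalIntegral.integral_of_le ?_
      rw [le_div_iff₀ ha2]
      nlinarith [sq_nonneg a]

theorem critLaw_real_Iic {p r : ℕ} (hr : 1 ≤ r) (hrp : r ≤ p) {a : ℝ} (ha0 : 0 ≤ a) (ha1 : a ≤ 1)
    (g : ℝ) : (critLaw p r a).real (Set.Iic g) = critCDF p r a g := by
  have := isProbabilityMeasure_chiSq (hr.trans hrp)
  have := isProbabilityMeasure_betaHalf hr hrp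
  have hm := measurable_mul_shrink a
  have hms : MeasurableSet (Set.Ioi g ∩ {w | w * (1 - a ^ 2) ≤ g}) :=
    measurableSet_Ioi.inter (measurableSet_le (by fun_prop) measurable_const)
  have hcdf : Measurable fun w => cdf (betaHalf r p) (mFun a √(g / w)) := by
    refine (cdf (betaHalf r p)).mono.measurable.comp ?_
    unfold mFun
    fun_prop
  rw [critCDF_eq hr hrp ha0 ha1, measureReal_def, critLaw, Measure.map_apply hm measurableSet_Iic,
    Measure.prod_apply (hm measurableSet_Iic),
    ← integral_toReal (measurable_measure_prodMk_left (hm measurableSet_Iic)).aemeasurable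
      (ae_of_all _ fun _ => measure_lt_top _ _)]
  have hae : (fun w => (betaHalf r p
      (Prod.mk w ⁻¹' ((fun x : ℝ × ℝ => x.1 * shrink a x.2) ⁻¹' Set.Iic g))).toReal) =ᵐ[chiSq p]
      fun w => (Set.Iic g).indicator (fun _ => 1) w +
        (Set.Ioi g ∩ {w | w * (1 - a ^ 2) ≤ g}).indicator
          (fun w => cdf (betaHalf r p) (mFun a √(g / w))) w := by
    filter_upwards [ae_chiSq_pos p] with w hw
    exact betaHalf_section hr hrp ha0 ha1 g hw
  rw [integral_congr_ae hae, integral_add ((integrable_const _).indicator measurableSet_Iic)]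
  · rw [integral_indicator measurableSet_Iic, integral_chiSq (hr.trans hrp) (Set.indicator _ _),
      ← integral_indicator hms]
    congr 1
    · simp
    · congr 1
      funext w
      rw [Set.indicator_mul_left]
  · refine Integrable.indicator ?_ hms
    refine Integrable.of_bound hcdf.aestronglyMeasurable 1 (ae_of_all _ fun w => ?_)
    rw [Real.norm_eq_abs, abs_of_nonneg (cdf_nonneg _ _)]
    exact cdf_le_one _ _

/-! ### Squared norms of the two blocks of a Gaussian vector -/

/-- Sum of the squares of the first block of coordinates. -/
def headSq {r q : ℕ} (z : EuclideanSpace ℝ (Fin r ⊕ Fin q)) : ℝ := ∑ i : Fin r, z (Sum.inl i) ^ 2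

/-- Sum of the squares of the second block of coordinates. -/
def tailSq {r q : ℕ} (z : EuclideanSpace ℝ (Fin r ⊕ Fin q)) : ℝ := ∑ i : Fin q, z (Sum.inr i) ^ 2

theorem map_headSq_tailSq {r q : ℕ} :
    (stdGaussian (EuclideanSpace ℝ (Fin r ⊕ Fin q))).map (fun z => (headSq z, tailSq z)) =
      ((Measure.pi fun _ : Fin r => gaussianReal 0 1).map (fun x => ∑ i, x i ^ 2)).prod
        ((Measure.pi fun _ : Fin q => gaussianReal 0 1).map (fun x => ∑ i, x i ^ 2)) := by
  unfold headSq tailSq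
  rw [← map_pi_eq_stdGaussian, Measure.map_map (by fun_prop) (by fun_prop),
    Measure.map_prod_map _ _ (by fun_prop) (by fun_prop),
    ← (measurePreserving_sumPiEquivProdPi fun _ : Fin r ⊕ Fin q => gaussianReal 0 1).map_eq,
    Measure.map_map (by fun_prop) (MeasurableEquiv.measurable _)]
  rfl

/-- The squared norm of a standard Gaussian vector and the fraction that the first block
contributes to it are independent, with chi-square and beta distributions. -/
theorem map_normSq_headSq_div {r q : ℕ} (hr : 1 ≤ r) :
    (stdGaussian (EuclideanSpace ℝ (Fin r ⊕ Fin q))).map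
      (fun z => (headSq z + tailSq z, headSq z / (headSq z + tailSq z))) =
      (chiSq (r + q)).prod (betaHalf r (r + q)) := by
  have h : (fun z : EuclideanSpace ℝ (Fin r ⊕ Fin q) =>
      (headSq z + tailSq z, headSq z / (headSq z + tailSq z))) =
      (fun x : ℝ × ℝ => (x.1 + x.2, x.1 / (x.1 + x.2))) ∘ fun z => (headSq z, tailSq z) := rfl
  rw [h, ← Measure.map_map (by fun_prop) (by unfold headSq tailSq; fun_prop), map_headSq_tailSq]
  obtain ⟨r, rfl⟩ := Nat.exists_eq_add_of_le' hr
  rw [map_sum_sq_pi_gaussianReal]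
  have := isProbabilityMeasure_chiSq (Nat.succ_pos r)
  -- With an empty second block the tail is the point mass at `0`, and the ratio is `w / w = 1`
  -- almost surely.
  rcases q with _ | q
  · have h0 : (Measure.pi fun _ : Fin 0 => gaussianReal 0 1).map (fun x => ∑ i, x i ^ 2) =
        Measure.dirac 0 := by
      simp [Measure.map_const]
    rw [h0, betaHalf, if_pos rfl, Measure.prod_dirac, Measure.prod_dirac,
      Measure.map_map (by fun_prop) (by fun_prop)]
    refine Measure.map_congr ?_
    filter_upwards [ae_chiSq_pos (r + 1)] with w hw
    simp [hw.ne']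
  · rw [map_sum_sq_pi_gaussianReal, betaHalf, if_neg (by omega), chiSq, chiSq,
      map_gamma_prod_gamma (by positivity) (by positivity) (by norm_num), chiSq]
    congr 2 <;> push_cast <;> ring

/-! ### The set of standardized errors for which the band covers -/

theorem headSq_nonneg {r q : ℕ} (z : EuclideanSpace ℝ (Fin r ⊕ Fin q)) : 0 ≤ headSq z :=
  Finset.sum_nonneg fun _ _ => sq_nonneg _

theorem tailSq_nonneg {r q : ℕ} (z : EuclideanSpace ℝ (Fin r ⊕ Fin q)) : 0 ≤ tailSq z :=
  Finset.sum_nonneg fun _ _ => sq_nonneg _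

theorem norm_sq_eq_headSq_add_tailSq {r q : ℕ} (z : EuclideanSpace ℝ (Fin r ⊕ Fin q)) :
    ‖z‖ ^ 2 = headSq z + tailSq z := by
  rw [EuclideanSpace.real_norm_sq_eq, Fintype.sum_sum_type]
  rfl

theorem inner_eq_sum_inl_add_sum_inr {r q : ℕ} (u z : EuclideanSpace ℝ (Fin r ⊕ Fin q)) :
    inner ℝ u z = ∑ i, u (Sum.inl i) * z (Sum.inl i) + ∑ i, u (Sum.inr i) * z (Sum.inr i) := by
  rw [PiLp.inner_apply, Fintype.sum_sum_type]
  simp [mul_comm]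

theorem abs_sum_mul_le {n : ℕ} (f g : Fin n → ℝ) :
    |∑ i, f i * g i| ≤ √(∑ i, f i ^ 2) * √(∑ i, g i ^ 2) := by
  rw [← Real.sqrt_mul (Finset.sum_nonneg fun _ _ => sq_nonneg _)]
  exact Real.abs_le_sqrt (Finset.sum_mul_sq_le_sq_mul_sq _ _ _)

/-- The set of errors `z` whose normalized contrasts with all directions `u` that have at least
the fraction `a ^ 2` of their squared norm in the first block are at most `c`. -/
def coverSet (r q : ℕ) (a c : ℝ) : Set (EuclideanSpace ℝ (Fin r ⊕ Fin q)) :=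
  {z | ∀ u : EuclideanSpace ℝ (Fin r ⊕ Fin q), a ^ 2 * ‖u‖ ^ 2 ≤ headSq u →
    |inner ℝ u z| ≤ c * ‖u‖}

/-- The squared supremum of the normalized contrasts with `z`. -/
noncomputable def supSq {r q : ℕ} (a : ℝ) (z : EuclideanSpace ℝ (Fin r ⊕ Fin q)) : ℝ :=
  (headSq z + tailSq z) * shrink a (headSq z / (headSq z + tailSq z))

theorem supSq_of_le {r q : ℕ} {a : ℝ} {z : EuclideanSpace ℝ (Fin r ⊕ Fin q)}
    (h : a ^ 2 * (headSq z + tailSq z) ≤ headSq z) : supSq a z = headSq z + tailSq z := by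
  rcases (add_nonneg (headSq_nonneg z) (tailSq_nonneg z)).eq_or_lt with h0 | h0
  · rw [supSq, ← h0, zero_mul]
  · rw [supSq, shrink, if_pos ((le_div_iff₀ h0).2 h), mul_one]

theorem supSq_of_lt {r q : ℕ} {a : ℝ} {z : EuclideanSpace ℝ (Fin r ⊕ Fin q)}
    (h : headSq z < a ^ 2 * (headSq z + tailSq z)) :
    supSq a z = (a * √(headSq z) + √(1 - a ^ 2) * √(tailSq z)) ^ 2 := by
  have hs := headSq_nonneg z
  have ht := tailSq_nonneg z
  have h0 : 0 < headSq z + tailSq z := by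
    by_contra h0
    nlinarith [sq_nonneg a]
  have e : 1 - headSq z / (headSq z + tailSq z) = tailSq z / (headSq z + tailSq z) := by
    field_simp
    ring
  rw [supSq, shrink, if_neg (not_le.2 ((div_lt_iff₀ h0).2 h)), e, Real.sqrt_div hs,
    Real.sqrt_div ht]
  have hw := Real.sq_sqrt h0.le
  have hw0 : √(headSq z + tailSq z) ≠ 0 := (Real.sqrt_pos.2 h0).ne'
  nth_rewrite 1 [← hw]
  field_simp

/-- In the plane, `(a, b)` spans the boundary ray of the cone, and `(ξ, η)` and `(s, t)` lie on
opposite sides of it. Their components normal to the ray thus contribute a nonpositive product,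
leaving the components along the ray. -/
theorem sq_add_le_of_cone {a b ξ η s t : ℝ} (ha : 0 ≤ a) (hb : 0 ≤ b) (hab : a ^ 2 + b ^ 2 = 1)
    (hξ : 0 ≤ ξ) (hs : 0 ≤ s) (ht : 0 ≤ t)
    (hu : a ^ 2 * (ξ ^ 2 + η ^ 2) ≤ ξ ^ 2) (hz : s ^ 2 ≤ a ^ 2 * (s ^ 2 + t ^ 2)) :
    ξ * s + η * t ≤ (a * s + b * t) * √(ξ ^ 2 + η ^ 2) := by
  have h1 : a * η ≤ b * ξ := abs_le_of_sq_le_sq' (by nlinarith) (by positivity) |>.2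
  have h2 : b * s ≤ a * t := abs_le_of_sq_le_sq' (by nlinarith) (by positivity) |>.2
  have h3 : a * ξ + b * η ≤ √(ξ ^ 2 + η ^ 2) := by
    refine Real.le_sqrt_of_sq_le ?_
    have : (a * ξ + b * η) ^ 2 + (a * η - b * ξ) ^ 2 = (a ^ 2 + b ^ 2) * (ξ ^ 2 + η ^ 2) := by ring
    nlinarith [sq_nonneg (a * η - b * ξ)]
  have h4 : ξ * s + η * t = (a * s + b * t) * (a * ξ + b * η) +
      (a * t - b * s) * (a * η - b * ξ) := by
    linear_combination (-(ξ * s + η * t)) * hab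
  rw [h4]
  nlinarith [mul_nonneg (sub_nonneg.2 h2) (sub_nonneg.2 h1),
    mul_le_mul_of_nonneg_left h3 (by positivity : 0 ≤ a * s + b * t)]

/-- Cauchy–Schwarz within each block reduces the claim to the plane of block norms. -/
theorem abs_inner_le_of_cone {r q : ℕ} {a : ℝ} (ha0 : 0 ≤ a) (ha1 : a ≤ 1)
    (z u : EuclideanSpace ℝ (Fin r ⊕ Fin q)) (hu : a ^ 2 * ‖u‖ ^ 2 ≤ headSq u) :
    |inner ℝ u z| ≤ √(supSq a z) * ‖u‖ := by
  rcases le_or_gt (a ^ 2 * (headSq z + tailSq z)) (headSq z) with h | h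
  · rw [supSq_of_le h, ← norm_sq_eq_headSq_add_tailSq, Real.sqrt_sq (norm_nonneg _), mul_comm]
    exact abs_real_inner_le_norm u z
  · have ha2 : 0 ≤ 1 - a ^ 2 := by nlinarith
    rw [supSq_of_lt h, Real.sqrt_sq (by positivity), ← Real.sqrt_sq (norm_nonneg u),
      norm_sq_eq_headSq_add_tailSq, inner_eq_sum_inl_add_sum_inr]
    rw [norm_sq_eq_headSq_add_tailSq] at hu
    refine (abs_add_le _ _).trans ((add_le_add (abs_sum_mul_le _ _) (abs_sum_mul_le _ _)).trans ?_)
    change √(headSq u) * √(headSq z) + √(tailSq u) * √(tailSq z) ≤ _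
    have e1 := Real.sq_sqrt (headSq_nonneg u)
    have e2 := Real.sq_sqrt (tailSq_nonneg u)
    have e3 := Real.sq_sqrt (headSq_nonneg z)
    have e4 := Real.sq_sqrt (tailSq_nonneg z)
    have key := sq_add_le_of_cone (ξ := √(headSq u)) (η := √(tailSq u)) (s := √(headSq z))
      (t := √(tailSq z)) ha0 (Real.sqrt_nonneg (1 - a ^ 2))
      (by rw [Real.sq_sqrt ha2]; ring) (Real.sqrt_nonneg _) (Real.sqrt_nonneg _)
      (Real.sqrt_nonneg _) (by rw [e1, e2]; exact hu)
      (by rw [e3, e4]; exact h.le)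
    rwa [e1, e2] at key

theorem exists_unit_sum_mul_eq_sqrt {n : ℕ} (hn : 0 < n) (f : Fin n → ℝ) :
    ∃ e : Fin n → ℝ, ∑ i, e i ^ 2 = 1 ∧ ∑ i, e i * f i = √(∑ i, f i ^ 2) := by
  have h0 : 0 ≤ ∑ i, f i ^ 2 := Finset.sum_nonneg fun _ _ => sq_nonneg _
  rcases h0.eq_or_lt with h | h
  · have hf : ∀ i, f i = 0 := fun i => by
      simpa using (Finset.sum_eq_zero_iff_of_nonneg fun _ _ => sq_nonneg _).1 h.symm i
        (Finset.mem_univ i)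
    refine ⟨Pi.single ⟨0, hn⟩ 1, ?_, ?_⟩
    · simp [Pi.single_apply]
    · simp [hf]
  · have hs := Real.sqrt_pos.2 h
    have hsq := Real.sq_sqrt h0
    refine ⟨fun i => (√(∑ i, f i ^ 2))⁻¹ * f i, ?_, ?_⟩
    · simp_rw [mul_pow, ← Finset.mul_sum, inv_pow]
      rw [hsq, inv_mul_cancel₀ h.ne']
    · simp_rw [mul_assoc, ← Finset.mul_sum, ← sq]
      nth_rewrite 2 [← hsq]
      field_simp

theorem mem_coverSet_iff {r q : ℕ} (hr : 1 ≤ r) {a c : ℝ} (ha0 : 0 ≤ a) (ha1 : a ≤ 1)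
    (hc : 0 ≤ c) (z : EuclideanSpace ℝ (Fin r ⊕ Fin q)) :
    z ∈ coverSet r q a c ↔ supSq a z ≤ c ^ 2 := by
  have hs := headSq_nonneg z
  have ht := tailSq_nonneg z
  have ha2 : 0 ≤ 1 - a ^ 2 := by nlinarith
  refine ⟨fun hz => ?_, fun h u hu => (abs_inner_le_of_cone ha0 ha1 z u hu).trans ?_⟩
  · rcases le_or_gt (a ^ 2 * (headSq z + tailSq z)) (headSq z) with h | h
    · have h1 := hz z (by rwa [norm_sq_eq_headSq_add_tailSq])
      rw [supSq_of_le h, ← norm_sq_eq_headSq_add_tailSq]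
      rw [real_inner_self_eq_norm_sq, abs_of_nonneg (sq_nonneg _)] at h1
      have h2 := norm_nonneg z
      have h3 : ‖z‖ ≤ c := by
        by_contra h3
        nlinarith
      exact pow_le_pow_left₀ h2 h3 2
    · have hT : 0 < tailSq z := by nlinarith
      have hq : 0 < q := by
        rcases Nat.eq_zero_or_pos q with rfl | hq
        · simp [tailSq] at hT
        · exact hq
      obtain ⟨e, he1, he2⟩ := exists_unit_sum_mul_eq_sqrt hr fun i => z (Sum.inl i)
      obtain ⟨d, hd1, hd2⟩ := exists_unit_sum_mul_eq_sqrt hq fun i => z (Sum.inr i)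
      -- Extremal direction when `z` is outside the cone: the boundary vector whose blocks are
      -- aligned with those of `z`.
      let u : EuclideanSpace ℝ (Fin r ⊕ Fin q) :=
        WithLp.toLp 2 (Sum.elim (fun i => a * e i) fun i => √(1 - a ^ 2) * d i)
      have hu1 : headSq u = a ^ 2 := by
        simp [headSq, u, mul_pow, ← Finset.mul_sum, he1]
      have hu2 : tailSq u = 1 - a ^ 2 := by
        simp [tailSq, u, mul_pow, ← Finset.mul_sum, hd1, Real.sq_sqrt ha2]
      have hu : ‖u‖ ^ 2 = 1 := by
        rw [norm_sq_eq_headSq_add_tailSq, hu1, hu2]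
        ring
      have hu' : ‖u‖ = 1 := by
        rw [← Real.sqrt_sq (norm_nonneg u), hu, Real.sqrt_one]
      have h1 := hz u (by rw [hu, hu1, mul_one])
      have hi : inner ℝ u z = a * √(headSq z) + √(1 - a ^ 2) * √(tailSq z) := by
        rw [inner_eq_sum_inl_add_sum_inr]
        simp only [u, Sum.elim_inl, Sum.elim_inr, mul_assoc, ← Finset.mul_sum, he2, hd2]
        rfl
      rw [supSq_of_lt h, ← hi, ← sq_abs]
      rw [hu', mul_one] at h1
      exact pow_le_pow_left₀ (abs_nonneg _) h1 2
  · refine mul_le_mul_of_nonneg_right ?_ (norm_nonneg u)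
    exact Real.sqrt_le_iff.2 ⟨hc, h⟩

theorem isClosed_coverSet (r q : ℕ) (a c : ℝ) : IsClosed (coverSet r q a c) := by
  simp only [coverSet, Set.ofPred_forall]
  refine isClosed_iInter fun u => isClosed_iInter fun _ => ?_
  exact isClosed_le (by fun_prop) continuous_const

/-- Moving `z` by less than `c - c'` changes every normalized contrast by less than that, uniformly
in `u`. This locates the frontier without continuity of `supSq`. -/
theorem coverSet_subset_interior {r q : ℕ} {a c c' : ℝ} (h : c' < c) :
    coverSet r q a c' ⊆ interior (coverSet r q a c) := by
  intro z hz
  rw [mem_interior_iff_mem_nhds, Metric.mem_nhds_iff]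
  refine ⟨c - c', sub_pos.2 h, fun y hy u hu => ?_⟩
  have e : inner ℝ u y = inner ℝ u z + inner ℝ u (y - z) := by
    rw [← inner_add_right, add_sub_cancel]
  have h1 := hz u hu
  have h2 := abs_real_inner_le_norm u (y - z)
  have h3 : ‖y - z‖ < c - c' := by rwa [← dist_eq_norm]
  rw [e]
  refine (abs_add_le _ _).trans ?_
  nlinarith [norm_nonneg u]

theorem frontier_coverSet_subset {r q : ℕ} (hr : 1 ≤ r) {a c : ℝ} (ha0 : 0 ≤ a) (ha1 : a ≤ 1)
    (hc : 0 ≤ c) : frontier (coverSet r q a c) ⊆ supSq a ⁻¹' {c ^ 2} := by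
  intro z hz
  rw [(isClosed_coverSet r q a c).frontier_eq] at hz
  refine le_antisymm ((mem_coverSet_iff hr ha0 ha1 hc z).1 hz.1) (not_lt.1 fun hlt => hz.2 ?_)
  have h0 : 0 ≤ supSq a z :=
    mul_nonneg (add_nonneg (headSq_nonneg z) (tailSq_nonneg z)) (shrink_nonneg _ _)
  refine coverSet_subset_interior (c' := √(supSq a z)) ?_
    ((mem_coverSet_iff hr ha0 ha1 (Real.sqrt_nonneg _) z).2 (Real.sq_sqrt h0).ge)
  have hc0 : 0 < c := hc.lt_of_ne (by rintro rfl; linarith [zero_pow (M₀ := ℝ) two_ne_zero])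
  exact (Real.sqrt_lt' hc0).2 hlt

theorem measurable_supSq {r q : ℕ} (a : ℝ) :
    Measurable (supSq a : EuclideanSpace ℝ (Fin r ⊕ Fin q) → ℝ) := by
  unfold supSq headSq tailSq
  have := measurable_shrink a
  fun_prop

theorem map_supSq_stdGaussian {r q : ℕ} (hr : 1 ≤ r) (a : ℝ) :
    (stdGaussian (EuclideanSpace ℝ (Fin r ⊕ Fin q))).map (supSq a) = critLaw (r + q) r a := by
  rw [critLaw, ← map_normSq_headSq_div hr, Measure.map_map (measurable_mul_shrink a)
    (by unfold headSq tailSq; fun_prop)]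
  rfl

/-! ### Standardizing the bands -/

theorem sqrt_mul_sqrt_of_posDef {p : ℕ} {F : Matrix (Fin p) (Fin p) ℝ} (hF : F.PosDef) :
    CFC.sqrt F * CFC.sqrt F = F :=
  CFC.sqrt_mul_sqrt_self F hF.posSemidef.nonneg

theorem isUnit_sqrt_of_posDef {p : ℕ} {F : Matrix (Fin p) (Fin p) ℝ} (hF : F.PosDef) :
    IsUnit (CFC.sqrt F).det := by
  have h := (Matrix.isUnit_iff_isUnit_det F).1 hF.isUnit
  rw [← sqrt_mul_sqrt_of_posDef hF, det_mul] at h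
  exact isUnit_of_mul_isUnit_left h

theorem transpose_sqrt {p : ℕ} (F : Matrix (Fin p) (Fin p) ℝ) :
    (CFC.sqrt F)ᵀ = CFC.sqrt F := by
  rw [← conjTranspose_eq_transpose_of_trivial]
  exact (Matrix.nonneg_iff_posSemidef.1 (CFC.sqrt_nonneg F)).isHermitian

theorem inv_eq_sqrt_inv_mul {p : ℕ} {F : Matrix (Fin p) (Fin p) ℝ} (hF : F.PosDef) :
    F⁻¹ = (CFC.sqrt F)⁻¹ * (CFC.sqrt F)⁻¹ := by
  conv_lhs => rw [← sqrt_mul_sqrt_of_posDef hF]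
  rw [Matrix.mul_inv_rev]

/-- A matrix with `r` linearly independent columns is the product of the matrix of the first `r`
vectors of an orthonormal basis and an invertible matrix. -/
theorem exists_orthonormalBasis_mul_eq {r q : ℕ} (V : Matrix (Fin (r + q)) (Fin r) ℝ)
    (hV : LinearIndependent ℝ V.col) :
    ∃ (b : OrthonormalBasis (Fin r ⊕ Fin q) ℝ (EuclideanSpace ℝ (Fin (r + q))))
      (K : Matrix (Fin r) (Fin r) ℝ), IsUnit K.det ∧
        V = (Matrix.of fun k i => b (Sum.inl i) k) * K := by
  let v : Fin r → EuclideanSpace ℝ (Fin (r + q)) := fun j => WithLp.toLp 2 (V.col j)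
  have hv : LinearIndependent ℝ v :=
    hV.map' (WithLp.linearEquiv 2 ℝ (Fin (r + q) → ℝ)).symm.toLinearMap
      (LinearEquiv.ker _)
  have hrank : Module.finrank ℝ (Submodule.span ℝ (Set.range v)) = r := by
    rw [finrank_span_eq_card hv, Fintype.card_fin]
  let b₀ := (stdOrthonormalBasis ℝ (Submodule.span ℝ (Set.range v))).reindex (finCongr hrank)
  -- The zeros on the second block are placeholders: only the first block is kept when the
  -- orthonormal family is extended.
  let f : Fin r ⊕ Fin q → EuclideanSpace ℝ (Fin (r + q)) := Sum.elim (fun i => b₀ i) 0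
  have hf : Orthonormal ℝ ((Set.range Sum.inl).domRestrict f) := by
    have h0 : Orthonormal ℝ (fun i => (b₀ i : EuclideanSpace ℝ (Fin (r + q)))) :=
      b₀.orthonormal.comp_linearIsometry (Submodule.subtypeₗᵢ _)
    have h1 := h0.comp (Equiv.ofInjective (Sum.inl : Fin r → Fin r ⊕ Fin q) Sum.inl_injective).symm
      (Equiv.injective _)
    convert h1 using 1
    funext ⟨x, i, hi⟩
    subst hi
    have e : (Equiv.ofInjective (Sum.inl : Fin r → Fin r ⊕ Fin q) Sum.inl_injective).symm
        ⟨Sum.inl i, i, rfl⟩ = i := Equiv.ofInjective_symm_apply _ i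
    simp [f, e]
  obtain ⟨b, hb⟩ := hf.exists_orthonormalBasis_extension_of_card_eq (by simp)
  have hb' : ∀ i, b (Sum.inl i) = b₀ i := fun i => hb _ ⟨i, rfl⟩
  let K : Matrix (Fin r) (Fin r) ℝ :=
    Matrix.of fun i j => b₀.repr ⟨v j, Submodule.subset_span ⟨j, rfl⟩⟩ i
  have hVK : V = (Matrix.of fun k i => b (Sum.inl i) k) * K := by
    ext k j
    have h := congrArg Subtype.val (b₀.sum_repr ⟨v j, Submodule.subset_span ⟨j, rfl⟩⟩)
    have h2 := congrArg (fun z : EuclideanSpace ℝ (Fin (r + q)) => z k) h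
    simp only [Submodule.coe_sum, Submodule.coe_smul, WithLp.ofLp_sum, Finset.sum_apply,
      WithLp.ofLp_smul, Pi.smul_apply, smul_eq_mul] at h2
    rw [Matrix.mul_apply]
    simp only [Matrix.of_apply, hb', K]
    rw [← show v j k = V k j from rfl, ← h2]
    exact Finset.sum_congr rfl fun i _ => mul_comm _ _
  refine ⟨b, K, ?_, hVK⟩
  rw [← Matrix.isUnit_iff_isUnit_det, ← Matrix.mulVec_injective_iff_isUnit]
  have hinj := Matrix.mulVec_injective_iff.2 hV
  intro x y hxy
  apply hinj
  change V *ᵥ x = V *ᵥ y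
  rw [hVK, ← Matrix.mulVec_mulVec, ← Matrix.mulVec_mulVec]
  exact congrArg _ hxy

theorem quadInv_eq {p : ℕ} {F : Matrix (Fin p) (Fin p) ℝ} (hF : F.PosDef) (x : Fin p → ℝ) :
    quadInv F x = ((CFC.sqrt F)⁻¹ *ᵥ x) ⬝ᵥ ((CFC.sqrt F)⁻¹ *ᵥ x) := by
  rw [quadInv, inv_eq_sqrt_inv_mul hF, ← Matrix.mulVec_mulVec, Matrix.dotProduct_mulVec,
    ← Matrix.mulVec_transpose, Matrix.transpose_nonsing_inv, transpose_sqrt]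

/-- An orthogonal projection depends only on the column span, so the change of basis `K` cancels. -/
theorem proj_mul_eq {r p : ℕ} {O : Matrix (Fin p) (Fin r) ℝ} {K : Matrix (Fin r) (Fin r) ℝ}
    (hO : Oᵀ * O = 1) (hK : IsUnit K.det) :
    (O * K) * ((O * K)ᵀ * (O * K))⁻¹ * (O * K)ᵀ = O * Oᵀ := by
  have e : (O * K)ᵀ * (O * K) = Kᵀ * K := by
    rw [Matrix.transpose_mul, Matrix.mul_assoc, ← Matrix.mul_assoc Oᵀ, hO, Matrix.one_mul]
  rw [e, Matrix.mul_inv_rev, Matrix.transpose_mul]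
  have h1 : K * K⁻¹ = 1 := Matrix.mul_nonsing_inv _ hK
  have h2 : (Kᵀ)⁻¹ * Kᵀ = 1 := Matrix.nonsing_inv_mul _ (by rwa [Matrix.det_transpose])
  calc O * K * (K⁻¹ * Kᵀ⁻¹) * (Kᵀ * Oᵀ) = O * (K * K⁻¹) * (Kᵀ⁻¹ * Kᵀ) * Oᵀ := by
        simp only [Matrix.mul_assoc]
    _ = O * Oᵀ := by rw [h1, h2, Matrix.mul_one, Matrix.mul_one]

/-- Coordinates in which the predictor space is standardized by the square root of `F` and the
span of the columns of `Z` becomes the first block. -/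
theorem exists_isometry_headSq_eq_quadProj {r q : ℕ} {F : Matrix (Fin (r + q)) (Fin (r + q)) ℝ}
    (hF : F.PosDef) (Z : Matrix (Fin (r + q)) (Fin r) ℝ) (hZ : LinearIndependent ℝ Z.col) :
    ∃ L : EuclideanSpace ℝ (Fin (r + q)) ≃ₗᵢ[ℝ] EuclideanSpace ℝ (Fin r ⊕ Fin q),
      ∀ x : Fin (r + q) → ℝ,
        headSq (L (WithLp.toLp 2 ((CFC.sqrt F)⁻¹ *ᵥ x))) = quadProj F Z x := by
  set R := CFC.sqrt F with hR
  have hRu : IsUnit R.det := isUnit_sqrt_of_posDef hF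
  have hRt : (R⁻¹)ᵀ = R⁻¹ := by rw [Matrix.transpose_nonsing_inv, hR, transpose_sqrt]
  have hV : LinearIndependent ℝ (R⁻¹ * Z).col := by
    rw [← Matrix.mulVec_injective_iff] at hZ ⊢
    have h1 : Function.Injective (R⁻¹).mulVec := by
      rw [Matrix.mulVec_injective_iff_isUnit, Matrix.isUnit_iff_isUnit_det]
      exact (Matrix.isUnit_nonsing_inv_det_iff).2 hRu
    have h2 : (R⁻¹ * Z).mulVec = (R⁻¹).mulVec ∘ Z.mulVec := by
      funext x
      exact (Matrix.mulVec_mulVec _ _ _).symm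
    rw [h2]
    exact h1.comp hZ
  obtain ⟨b, K, hK, hVK⟩ := exists_orthonormalBasis_mul_eq (R⁻¹ * Z) hV
  set O : Matrix (Fin (r + q)) (Fin r) ℝ := Matrix.of fun k i => b (Sum.inl i) k with hOdef
  have hO : Oᵀ * O = 1 := by
    ext i j
    have h := (orthonormal_iff_ite.1 b.orthonormal) (Sum.inl i) (Sum.inl j)
    rw [PiLp.inner_apply] at h
    rw [Matrix.mul_apply, Matrix.one_apply]
    simp only [Sum.inl.injEq] at h
    rw [← h]
    refine Finset.sum_congr rfl fun k _ => ?_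
    simp [O, mul_comm]
  refine ⟨b.repr, fun x => ?_⟩
  have hmat : F⁻¹ * Z * (Zᵀ * F⁻¹ * Z)⁻¹ * Zᵀ * F⁻¹ = R⁻¹ * (O * Oᵀ) * R⁻¹ := by
    rw [← proj_mul_eq hO hK, ← hVK, Matrix.transpose_mul, hRt, inv_eq_sqrt_inv_mul hF, ← hR]
    simp only [Matrix.mul_assoc]
  have hq : quadProj F Z x = (Oᵀ *ᵥ (R⁻¹ *ᵥ x)) ⬝ᵥ (Oᵀ *ᵥ (R⁻¹ *ᵥ x)) := by
    rw [quadProj, hmat, ← Matrix.mulVec_mulVec, ← Matrix.mulVec_mulVec, ← Matrix.mulVec_mulVec,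
      Matrix.dotProduct_mulVec, ← Matrix.mulVec_transpose, hRt, Matrix.dotProduct_mulVec,
      ← Matrix.mulVec_transpose]
  rw [hq, headSq, dotProduct]
  refine Finset.sum_congr rfl fun i _ => ?_
  rw [b.repr_apply_apply, PiLp.inner_apply, sq]
  simp [O, Matrix.mulVec, dotProduct, mul_comm]

/-- The map `x ↦ L (R⁻¹ x)` is a bijection from the region onto the cone, and it turns the error at
`x` into an inner product with the rotated standardized error. -/
theorem linearBandCovers_iff_mem_coverSet {r q : ℕ}
    {F : Matrix (Fin (r + q)) (Fin (r + q)) ℝ} (hF : F.PosDef)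
    {Z : Matrix (Fin (r + q)) (Fin r) ℝ}
    {L : EuclideanSpace ℝ (Fin (r + q)) ≃ₗᵢ[ℝ] EuclideanSpace ℝ (Fin r ⊕ Fin q)}
    (hL : ∀ x : Fin (r + q) → ℝ,
      headSq (L (WithLp.toLp 2 ((CFC.sqrt F)⁻¹ *ᵥ x))) = quadProj F Z x)
    (a c : ℝ) (β b : Fin (r + q) → ℝ) :
    LinearBandCovers F (region F Z a) c β b ↔
      L (WithLp.toLp 2 (CFC.sqrt F *ᵥ (b - β))) ∈ coverSet r q a c := by
  set R := CFC.sqrt F with hR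
  have hRu : IsUnit R.det := isUnit_sqrt_of_posDef hF
  have hnorm : ∀ x : Fin (r + q) → ℝ, ‖L (WithLp.toLp 2 (R⁻¹ *ᵥ x))‖ ^ 2 = quadInv F x := fun x => by
    rw [L.norm_map, EuclideanSpace.real_norm_sq_eq, quadInv_eq hF, dotProduct]
    exact Finset.sum_congr rfl fun i _ => sq _
  have hsqrt : ∀ x : Fin (r + q) → ℝ, √(quadInv F x) = ‖L (WithLp.toLp 2 (R⁻¹ *ᵥ x))‖ := fun x => by
    rw [← hnorm, Real.sqrt_sq (norm_nonneg _)]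
  have hinner : ∀ x : Fin (r + q) → ℝ, inner ℝ (L (WithLp.toLp 2 (R⁻¹ *ᵥ x)))
      (L (WithLp.toLp 2 (R *ᵥ (b - β)))) = x ⬝ᵥ b - x ⬝ᵥ β := fun x => by
    rw [L.inner_map_map, EuclideanSpace.inner_toLp_toLp, star_trivial, dotProduct_comm,
      Matrix.dotProduct_mulVec, ← Matrix.mulVec_transpose, transpose_sqrt, ← hR,
      Matrix.mulVec_mulVec, Matrix.mul_nonsing_inv _ hRu, Matrix.one_mulVec, dotProduct_sub]
  have key : ∀ x : Fin (r + q) → ℝ,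
      x ⬝ᵥ β ∈ Set.Icc (x ⬝ᵥ b - c * √(quadInv F x)) (x ⬝ᵥ b + c * √(quadInv F x)) ↔
      |inner ℝ (L (WithLp.toLp 2 (R⁻¹ *ᵥ x))) (L (WithLp.toLp 2 (R *ᵥ (b - β))))| ≤
        c * ‖L (WithLp.toLp 2 (R⁻¹ *ᵥ x))‖ := fun x => by
    rw [hinner, ← hsqrt, abs_le, Set.mem_Icc]
    constructor <;> rintro ⟨h1, h2⟩ <;> constructor <;> linarith
  constructor
  · intro h u hu
    have hx : u = L (WithLp.toLp 2 (R⁻¹ *ᵥ (R *ᵥ (WithLp.ofLp (L.symm u))))) := by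
      rw [Matrix.mulVec_mulVec, Matrix.nonsing_inv_mul _ hRu, Matrix.one_mulVec, WithLp.toLp_ofLp,
        L.apply_symm_apply]
    rw [hx] at hu ⊢
    rw [← key]
    refine h _ ?_
    rwa [hL, hnorm] at hu
  · intro h x hx
    rw [key]
    refine h _ ?_
    rw [hL, hnorm]
    exact hx

/-- The logistic function is strictly increasing, so it carries one band to the other. -/
theorem probBandCovers_iff {p : ℕ} (F : Matrix (Fin p) (Fin p) ℝ) (S : Set (Fin p → ℝ)) (c : ℝ)
    (β b : Fin p → ℝ) : ProbBandCovers F S c β b ↔ LinearBandCovers F S c β b := by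
  refine forall₂_congr fun x _ => ?_
  have hmono : ∀ s t : ℝ, (1 + Real.exp s)⁻¹ ≤ (1 + Real.exp t)⁻¹ ↔ t ≤ s := fun s t => by
    rw [inv_le_inv₀ (by positivity) (by positivity), add_le_add_iff_left, Real.exp_le_exp]
  rw [responseProb, one_div, Set.mem_Icc, Set.mem_Icc, hmono, hmono]
  constructor <;> rintro ⟨h1, h2⟩ <;> constructor <;> linarith

/-! ### Weak convergence to a rotation invariant law -/

/-- The maps are treated as independent random elements with Dirac laws: product laws converge, and
evaluation is jointly continuous. -/
theorem tendsto_map_of_tendsto_continuousLinearMap {E W : Type*}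
    [NormedAddCommGroup E] [NormedSpace ℝ E] [FiniteDimensional ℝ E] [MeasurableSpace E]
    [BorelSpace E] [NormedAddCommGroup W] [NormedSpace ℝ W] [FiniteDimensional ℝ W]
    [MeasurableSpace W] [BorelSpace W] {ν : ℕ → ProbabilityMeasure E} {γ : ProbabilityMeasure E}
    (hν : Tendsto ν atTop (𝓝 γ)) {L : ℕ → E →L[ℝ] W} {M : E →L[ℝ] W}
    (hL : Tendsto L atTop (𝓝 M)) :
    Tendsto (fun n => (ν n).map (L n).continuous.measurable.aemeasurable) atTop
      (𝓝 (γ.map M.continuous.measurable.aemeasurable)) := by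
  have : SecondCountableTopology E := by
    have := FiniteDimensional.proper ℝ E
    infer_instance
  have : SecondCountableTopology (E →L[ℝ] W) := by
    have := FiniteDimensional.proper ℝ (E →L[ℝ] W)
    infer_instance
  have hev : Continuous fun x : E × (E →L[ℝ] W) => x.2 x.1 := by fun_prop
  have hmap : ∀ (μ : ProbabilityMeasure E) (N : E →L[ℝ] W),
      (μ.prod (diracProba N)).map hev.measurable.aemeasurable =
        μ.map N.continuous.measurable.aemeasurable := fun μ N => by
    refine Subtype.ext ?_
    change Measure.map _ ((μ : Measure E).prod (Measure.dirac N)) = Measure.map _ _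
    rw [Measure.prod_dirac, Measure.map_map hev.measurable (by fun_prop)]
    rfl
  have h1 : Tendsto (fun n => (ν n).prod (diracProba (L n))) atTop
      (𝓝 (γ.prod (diracProba M))) :=
    (ProbabilityMeasure.continuous_prod.tendsto (γ, diracProba M)).comp
      (hν.prodMk_nhds ((continuous_diracProba.tendsto M).comp hL))
  have h2 := ProbabilityMeasure.tendsto_map_of_tendsto_of_continuous _ _ h1 hev
  simpa only [hmap] using h2

/-- Isometric images of laws that converge weakly to the standard Gaussian law converge to the
standard Gaussian law, even if the isometries do not converge. -/
theorem tendsto_map_linearIsometryEquiv_stdGaussian {E W : Type*}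
    [NormedAddCommGroup E] [InnerProductSpace ℝ E] [FiniteDimensional ℝ E] [MeasurableSpace E]
    [BorelSpace E] [NormedAddCommGroup W] [InnerProductSpace ℝ W] [FiniteDimensional ℝ W]
    [MeasurableSpace W] [BorelSpace W] {ν : ℕ → ProbabilityMeasure E}
    (hν : Tendsto ν atTop (𝓝 ⟨stdGaussian E, inferInstance⟩)) (L : ℕ → E ≃ₗᵢ[ℝ] W) :
    Tendsto (fun n => (ν n).map (L n).continuous.measurable.aemeasurable) atTop
      (𝓝 (⟨stdGaussian W, inferInstance⟩ : ProbabilityMeasure W)) := by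
  refine tendsto_of_subseq_tendsto fun ns hns => ?_
  have := FiniteDimensional.proper ℝ (E →L[ℝ] W)
  let A : ℕ → E →L[ℝ] W := fun n => (L (ns n)).toContinuousLinearEquiv
  have hA : ∀ n, A n ∈ Metric.closedBall (0 : E →L[ℝ] W) 1 := fun n => by
    rw [mem_closedBall_zero_iff]
    exact ContinuousLinearMap.opNorm_le_bound _ zero_le_one fun x => by
      rw [one_mul]
      exact ((L (ns n)).norm_map x).le
  obtain ⟨M, -, ms, hms, hM⟩ := (isCompact_closedBall (0 : E →L[ℝ] W) 1).tendsto_subseq hA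
  have hnorm : ∀ x, ‖M x‖ = ‖x‖ := fun x => by
    have h1 : Tendsto (fun n => ‖(A ∘ ms) n x‖) atTop (𝓝 ‖M x‖) :=
      (((ContinuousLinearMap.apply ℝ W x).continuous.tendsto M).comp hM).norm
    refine tendsto_nhds_unique h1 ?_
    have h2 : (fun n => ‖(A ∘ ms) n x‖) = fun _ => ‖x‖ := by
      funext n
      exact (L (ns (ms n))).norm_map x
    rw [h2]
    exact tendsto_const_nhds
  -- The limit preserves norms; equality of dimensions, read off from `L 0`, makes it onto.
  let M' : E ≃ₗᵢ[ℝ] W := LinearIsometry.toLinearIsometryEquiv ⟨M.toLinearMap, hnorm⟩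
    (L 0).toLinearEquiv.finrank_eq
  refine ⟨ms, ?_⟩
  have h := tendsto_map_of_tendsto_continuousLinearMap
    (hν.comp (hns.comp hms.tendsto_atTop)) hM
  have hlim : ProbabilityMeasure.map ⟨stdGaussian E, inferInstance⟩
      M.continuous.measurable.aemeasurable = ⟨stdGaussian W, inferInstance⟩ := by
    refine Subtype.ext ?_
    exact stdGaussian_map M'
  rw [hlim] at h
  exact h

/-! ### Limiting coverage probability -/

theorem shrink_pos {a b : ℝ} (ha0 : 0 ≤ a) (hb : 0 < b) : 0 < shrink a b := by
  unfold shrink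
  split_ifs with h
  · exact one_pos
  · have ha : 0 < a := by
      refine ha0.lt_of_ne ?_
      rintro rfl
      exact h (by simpa using hb.le)
    have := Real.sqrt_pos.2 hb
    positivity

/-- Excludes the critical value `0`, the only place where an atom was not ruled out. -/
theorem critLaw_real_Iic_zero {p r : ℕ} (hr : 1 ≤ r) (hrp : r ≤ p) {a : ℝ} (ha0 : 0 ≤ a) :
    (critLaw p r a).real (Set.Iic 0) = 0 := by
  have := isProbabilityMeasure_chiSq (hr.trans hrp)
  have := isProbabilityMeasure_betaHalf hr hrp
  rw [critLaw, map_measureReal_apply (measurable_mul_shrink a) measurableSet_Iic]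
  refine (measureReal_congr (t := ∅) ?_).trans measureReal_empty
  filter_upwards [Measure.quasiMeasurePreserving_fst.ae (ae_chiSq_pos p),
    Measure.quasiMeasurePreserving_snd.ae (ae_betaHalf_mem r p)] with x hw hb
  exact propext (iff_of_false (mul_pos hw (shrink_pos ha0 hb.1)).not_ge id)

theorem tendsto_measureReal_coverSet {r q : ℕ} (hr : 1 ≤ r) {a c : ℝ} (ha0 : 0 ≤ a) (ha1 : a ≤ 1)
    (hc : 0 < c) {ν : ℕ → ProbabilityMeasure (EuclideanSpace ℝ (Fin r ⊕ Fin q))}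
    (hν : Tendsto ν atTop (𝓝 ⟨stdGaussian _, inferInstance⟩)) :
    Tendsto (fun n => (ν n : Measure _).real (coverSet r q a c)) atTop
      (𝓝 ((critLaw (r + q) r a).real (Set.Iic (c ^ 2)))) := by
  have hlim : (critLaw (r + q) r a).real (Set.Iic (c ^ 2)) =
      (stdGaussian (EuclideanSpace ℝ (Fin r ⊕ Fin q))).real (coverSet r q a c) := by
    rw [← map_supSq_stdGaussian hr, map_measureReal_apply (measurable_supSq a) measurableSet_Iic]
    congr 1
    ext z
    exact (mem_coverSet_iff hr ha0 ha1 hc.le z).symm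
  have hnull : stdGaussian (EuclideanSpace ℝ (Fin r ⊕ Fin q)) (frontier (coverSet r q a c)) = 0 := by
    refine measure_mono_null (frontier_coverSet_subset hr ha0 ha1 hc.le) ?_
    rw [← Measure.map_apply (measurable_supSq a) (measurableSet_singleton _),
      map_supSq_stdGaussian hr]
    exact critLaw_singleton hr (Nat.le_add_right r q) a (pow_pos hc 2).ne'
  rw [hlim]
  exact (ENNReal.tendsto_toReal (measure_ne_top _ _)).comp
    (ProbabilityMeasure.tendsto_measure_of_null_frontier_of_tendsto' hν hnull)

theorem tendsto_prob_linearBandCovers {r q : ℕ} (hr : 1 ≤ r)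
    {Z : Matrix (Fin (r + q)) (Fin r) ℝ} (hZ : LinearIndependent ℝ Z.col)
    {a c : ℝ} (ha0 : 0 ≤ a) (ha1 : a ≤ 1) (hc : 0 < c)
    {Ω : ℕ → Type*} [∀ n, MeasurableSpace (Ω n)]
    {P : ∀ n, Measure (Ω n)} [∀ n, IsProbabilityMeasure (P n)] {β : Fin (r + q) → ℝ}
    {F : ℕ → Matrix (Fin (r + q)) (Fin (r + q)) ℝ} {est : ∀ n, Ω n → Fin (r + q) → ℝ}
    (h : IsAsympNormal P β F est) :
    Tendsto (fun n => (P n).real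
        {ω | LinearBandCovers (F n) (region (F n) Z a) c β (est n ω)})
      atTop (𝓝 ((critLaw (r + q) r a).real (Set.Iic (c ^ 2)))) := by
  obtain ⟨hpos, hdist⟩ := h
  have hex : ∀ n, ∃ L : EuclideanSpace ℝ (Fin (r + q)) ≃ₗᵢ[ℝ] EuclideanSpace ℝ (Fin r ⊕ Fin q),
      (F n).PosDef → ∀ x : Fin (r + q) → ℝ,
        headSq (L (WithLp.toLp 2 ((CFC.sqrt (F n))⁻¹ *ᵥ x))) = quadProj (F n) Z x := fun n => by
    by_cases hn : (F n).PosDef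
    · obtain ⟨L, hL⟩ := exists_isometry_headSq_eq_quadProj hn Z hZ
      exact ⟨L, fun _ => hL⟩
    -- Any isometry serves for the finitely many `n` at which `F n` is not positive definite.
    · exact ⟨LinearIsometryEquiv.piLpCongrLeft 2 ℝ ℝ finSumFinEquiv.symm, fun hn' => absurd hn' hn⟩
  choose L hL using hex
  have hlim := hdist.tendsto
  simp only [Measure.map_id] at hlim
  have hconv := tendsto_measureReal_coverSet (a := a) hr ha0 ha1 hc
    (tendsto_map_linearIsometryEquiv_stdGaussian hlim L)
  refine hconv.congr' ?_
  filter_upwards [hpos] with n hn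
  have hmeas : MeasurableSet (coverSet r q a c) := (isClosed_coverSet r q a c).measurableSet
  have hLm : Measurable (L n) := (L n).continuous.measurable
  change (Measure.map (L n) (Measure.map _ (P n))).real _ = _
  rw [map_measureReal_apply hLm hmeas, measureReal_def, measureReal_def,
    Measure.map_apply_of_aemeasurable (hdist.forall_aemeasurable n) (hLm hmeas)]
  congr 2
  ext ω
  exact (linearBandCovers_iff_mem_coverSet hn (hL n hn) a c β (est n ω)).symm

end LogisticBand

theorem theorem1 {p r : ℕ} (hr : 1 ≤ r) (hrp : r ≤ p)
    (Z : Matrix (Fin p) (Fin r) ℝ) (hZ : LinearIndependent ℝ Z.col)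
    (a : ℝ) (ha0 : 0 ≤ a) (ha1 : a ≤ 1)
    {Ω : ℕ → Type*} [∀ n, MeasurableSpace (Ω n)]
    (P : ∀ n, Measure (Ω n)) [∀ n, IsProbabilityMeasure (P n)]
    (β : Fin p → ℝ)
    (X : ∀ n, Fin n → Fin p → ℝ) (Y : ∀ n, Fin n → Ω n → ℝ)
    (hY : ∀ n, IsLogisticSample (P n) β (X n) (Y n))
    (F : ℕ → Matrix (Fin p) (Fin p) ℝ)
    (hF : ∀ n, F n = fisherInfo (P n) β (X n) (Y n))
    (est : ∀ n, Ω n → Fin p → ℝ) (hest : ∀ n, IsMLE (X n) (Y n) (est n))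
    (hnormal : IsAsympNormal P β F est) :
    ∃ G : Measure ℝ, IsProbabilityMeasure G ∧
      (∀ g : ℝ, G.real (Set.Iic g) = critCDF p r a g) ∧
      ∀ α c : ℝ, 0 < α → α < 1 → 0 ≤ c → G.real (Set.Iic (c ^ 2)) = 1 - α →
        Tendsto (fun n => (P n).real
            {ω | LinearBandCovers (F n) (region (F n) Z a) c β (est n ω)})
          atTop (𝓝 (1 - α)) ∧
        Tendsto (fun n => (P n).real
            {ω | ProbBandCovers (F n) (region (F n) Z a) c β (est n ω)})
          atTop (𝓝 (1 - α)) := by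
  obtain ⟨q, rfl⟩ := Nat.exists_eq_add_of_le hrp
  refine ⟨critLaw (r + q) r a, isProbabilityMeasure_critLaw hr hrp a,
    critLaw_real_Iic hr hrp ha0 ha1, fun α c _ hα1 hc hG => ?_⟩
  -- At `c = 0` the coverage would be `0`, whereas `1 - α > 0`.
  have hc0 : 0 < c := by
    refine hc.lt_of_ne ?_
    rintro rfl
    rw [zero_pow two_ne_zero, critLaw_real_Iic_zero hr hrp ha0] at hG
    linarith
  simp_rw [probBandCovers_iff, and_self]
  rw [← hG]
  exact tendsto_prob_linearBandCovers hr hZ ha0 ha1 hc0 hnormal
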